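/- Let $n\in\mathbb{N}$ and let $V\subset\mathbb{R}^n$ be an open, convex set, symmetric (invariant under permutations of the coordinates), with $\partial V\neq\emptyset$ of class $C^1$, whose inner unit normal $\nu$ satisfies, at every $\lambda\in\partial V$, $\nu_i(\lambda)>0$ for $i=1,\dots,n$ and $\nu(\lambda)\cdot\lambda>0$. Let $\Omega\subset\mathbb{R}^n$ be a domain (non-empty, open, connected). For a symmetric matrix $M$ let $\lambda(M)\in\mathbb{R}^n$ be the vector of its eigenvalues, counted with multiplicity. An upper semicontinuous function $w:\Omega\to\mathbb{R}\cup\{-\infty\}$, $w\not\equiv-\infty$, is a viscosity subsolution of $\lambda(D^2w)\in\partial V$ in $\Omega$ if for all $x_0\in\Omega$ and $\varphi\in C^2(\Omega)$ with $w(x_0)=\varphi(x_0)$ and $w\le\varphi$ in $\Omega$ one has $\lambda(D^2\varphi(x_0))\in\overline{V}$. A lower semicontinuous function $w:\Omega\to\mathbb{R}\cup\{+\infty\}$, $w\not\equiv+\infty$, is a viscosity supersolution if for all $x_0\in\Omega$ and $\varphi\in C^2(\Omega)$ with $w(x_0)=\varphi(x_0)$ and $w\ge\varphi$ in $\Omega$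 one has $\lambda(D^2\varphi(x_0))\in\mathbb{R}^n\setminus V$. A viscosity solution is a function $w\in C^0(\Omega)$ that is both. If $u$ and $v$ are viscosity solutions of $\lambda(D^2u)\in\partial V$ in $\Omega$, then for every $0<\alpha<1$ the function $\alpha u+(1-\alpha)v$ is a viscosity subsolution of $\lambda(D^2u)\in\partial V$ in $\Omega$. -/

import Mathlib

open Set

noncomputable section

namespace ViscositySpectral

/-- `ρ` is a `C¹` defining function of the open set `V` near the boundary point `p`:
on a small ball around `p` the set `V` is `{ρ > 0}`, and `∇ρ(p) ≠ 0`. -/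
def IsLocalDefiningFunction {n : ℕ} (V : Set (EuclideanSpace ℝ (Fin n)))
    (p : EuclideanSpace ℝ (Fin n)) (ρ : EuclideanSpace ℝ (Fin n) → ℝ) : Prop :=
  ∃ r : ℝ, 0 < r ∧ ContDiffOn ℝ 1 ρ (Metric.ball p r) ∧ gradient ρ p ≠ 0 ∧
    ∀ x ∈ Metric.ball p r, x ∈ V ↔ 0 < ρ x

/-- The boundary of the open set `V` is of class `C¹`. -/
def HasC1Boundary {n : ℕ} (V : Set (EuclideanSpace ℝ (Fin n))) : Prop :=
  ∀ p ∈ frontier V, ∃ ρ, IsLocalDefiningFunction V p ρ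

/-- `ν` is the inner unit normal of `∂V` at the boundary point `p`, that is `∇ρ(p) / |∇ρ(p)|`
for a `C¹` defining function `ρ` (positive in `V`). -/
def IsInnerUnitNormal {n : ℕ} (V : Set (EuclideanSpace ℝ (Fin n)))
    (p ν : EuclideanSpace ℝ (Fin n)) : Prop :=
  ∃ ρ, IsLocalDefiningFunction V p ρ ∧ ν = ‖gradient ρ p‖⁻¹ • gradient ρ p

/-- The standing conditions on the set `V` in the equation `λ(D²u) ∈ ∂V`. -/
structure IsAdmissible {n : ℕ} (V : Set (EuclideanSpace ℝ (Fin n))) : Prop where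
  isOpen : IsOpen V
  convex : Convex ℝ V
  symmetric : ∀ (σ : Equiv.Perm (Fin n)) (l : EuclideanSpace ℝ (Fin n)),
    l ∈ V → WithLp.toLp 2 (fun i => l (σ i)) ∈ V
  frontier_nonempty : (frontier V).Nonempty
  c1_boundary : HasC1Boundary V
  normal_pos : ∀ p ∈ frontier V, ∀ ν, IsInnerUnitNormal V p ν → ∀ i, 0 < ν i
  normal_inner_pos : ∀ p ∈ frontier V, ∀ ν, IsInnerUnitNormal V p ν → 0 < inner ℝ ν p

/-- The Hessian matrix `D²φ(x)`. -/
def hessian {n : ℕ} (φ : EuclideanSpace ℝ (Fin n) → ℝ) (x : EuclideanSpace ℝ (Fin n)) :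
    Matrix (Fin n) (Fin n) ℝ :=
  Matrix.of fun i j =>
    fderiv ℝ (fderiv ℝ φ) x (EuclideanSpace.single i 1) (EuclideanSpace.single j 1)

open Classical in
/-- The vector `λ(M)` of the eigenvalues, with multiplicity, of a symmetric real matrix `M`
(the order plays no role, as it is only tested against symmetric sets). The value `0` for
non-symmetric `M` is never used: see `hessian_isHermitian`. -/
def eigenvalueVector {n : ℕ} (M : Matrix (Fin n) (Fin n) ℝ) : EuclideanSpace ℝ (Fin n) :=
  if hM : M.IsHermitian then WithLp.toLp 2 hM.eigenvalues else 0

theorem eigenvalueVector_of_isHermitian {n : ℕ} {M : Matrix (Fin n) (Fin n) ℝ}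
    (hM : M.IsHermitian) : eigenvalueVector M = WithLp.toLp 2 hM.eigenvalues := by
  exact dif_pos hM

/-- The Hessian of a `C²` function on an open set is symmetric. -/
theorem hessian_isHermitian {n : ℕ} {Ω : Set (EuclideanSpace ℝ (Fin n))} (hΩ : IsOpen Ω)
    {φ : EuclideanSpace ℝ (Fin n) → ℝ} (hφ : ContDiffOn ℝ 2 φ Ω)
    {x : EuclideanSpace ℝ (Fin n)} (hx : x ∈ Ω) : (hessian φ x).IsHermitian := by
  have h : ContDiffAt ℝ 2 φ x := hφ.contDiffAt (hΩ.mem_nhds hx)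
  have hs : IsSymmSndFDerivAt ℝ φ x := h.isSymmSndFDerivAt (by simp)
  ext i j
  simpa [hessian] using hs _ _

/-- `u ∈ USC(Ω)`, with values in `ℝ ∪ {-∞}` and not identically `-∞`, is a viscosity
subsolution of `λ(D²u) ∈ ∂V` in `Ω`. -/
def IsViscositySubsolution {n : ℕ} (V Ω : Set (EuclideanSpace ℝ (Fin n)))
    (u : EuclideanSpace ℝ (Fin n) → EReal) : Prop :=
  UpperSemicontinuousOn u Ω ∧ (∀ x ∈ Ω, u x ≠ ⊤) ∧ (∃ x ∈ Ω, u x ≠ ⊥) ∧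
    ∀ x₀ ∈ Ω, ∀ φ : EuclideanSpace ℝ (Fin n) → ℝ, ContDiffOn ℝ 2 φ Ω →
      u x₀ = (φ x₀ : EReal) → (∀ x ∈ Ω, u x ≤ (φ x : EReal)) →
        eigenvalueVector (hessian φ x₀) ∈ closure V

/-- `u ∈ LSC(Ω)`, with values in `ℝ ∪ {+∞}` and not identically `+∞`, is a viscosity
supersolution of `λ(D²u) ∈ ∂V` in `Ω`. -/
def IsViscositySupersolution {n : ℕ} (V Ω : Set (EuclideanSpace ℝ (Fin n)))
    (u : EuclideanSpace ℝ (Fin n) → EReal) : Prop :=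
  LowerSemicontinuousOn u Ω ∧ (∀ x ∈ Ω, u x ≠ ⊥) ∧ (∃ x ∈ Ω, u x ≠ ⊤) ∧
    ∀ x₀ ∈ Ω, ∀ φ : EuclideanSpace ℝ (Fin n) → ℝ, ContDiffOn ℝ 2 φ Ω →
      u x₀ = (φ x₀ : EReal) → (∀ x ∈ Ω, (φ x : EReal) ≤ u x) →
        eigenvalueVector (hessian φ x₀) ∉ V

/-- `u ∈ C⁰(Ω)` is a viscosity solution of `λ(D²u) ∈ ∂V` in `Ω`. -/
def IsViscositySolution {n : ℕ} (V Ω : Set (EuclideanSpace ℝ (Fin n)))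
    (u : EuclideanSpace ℝ (Fin n) → ℝ) : Prop :=
  ContinuousOn u Ω ∧ IsViscositySubsolution V Ω (fun x => (u x : EReal)) ∧
    IsViscositySupersolution V Ω (fun x => (u x : EReal))

end ViscositySpectral

end

/-! The nonlinear condition is an intersection of linear ones, and for linear equations subsolutions
can be averaged. Linearization: if the eigenvalues of `M₀ = D²φ(x₀)` lie outside the closure of `V`,
project them onto that closure. The resulting separating normal `N` is a positive multiple of the
gradient of a defining function, so its entries are positive. In an eigenbasis `b` of `M₀`, the
diagonal of any symmetric `M` is the image of `λ(M)` under a doubly stochastic matrix, so by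
Birkhoff it stays in the convex symmetric set. Hence `∑ N k * ⟨b k, M b k⟩ ≥ c` whenever `λ(M)` lies
in the closure, while `M₀` violates this (`IsAdmissible.exists_linear_bound`). Both `u` and `v` are
thus viscosity subsolutions of `L w ≥ c`, with `L = dirOp N b` elliptic and of constant
coefficients. Averaging (`IsLocalSubsolution.convexComb`): on a small ball, dominate `u` and `v` by
smooth solutions of `L h = c` with nearly the same boundary values. Their convex combination is
again a smooth solution, and comparing it with a perturbed test function gives the claim. The smooth
solutions are polynomials, obtained by linear algebra and the maximum principle. -/

noncomputable section

namespace ViscositySpectral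

/-! ### Supporting hyperplanes with positive normal -/

/-- A vector which pairs nonnegatively with the open half-space of directions `d` with
`⟪g, d⟫ > 0` is a multiple of `g`. -/
theorem eq_smul_of_inner_nonneg {F : Type*} [NormedAddCommGroup F] [InnerProductSpace ℝ F]
    {g N : F} (hg : g ≠ 0) (h : ∀ d : F, 0 < inner ℝ g d → 0 ≤ inner ℝ N d) :
    N = (inner ℝ g N / ‖g‖ ^ 2) • g := by
  have hg2 : 0 < ‖g‖ ^ 2 := by positivity
  set w := N - (inner ℝ g N / ‖g‖ ^ 2) • g with hw
  have hgw : inner ℝ g w = 0 := by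
    rw [hw, inner_sub_right, inner_smul_right, real_inner_self_eq_norm_sq]
    field_simp
    ring
  have hNw : inner ℝ N w = ‖w‖ ^ 2 := by
    have : N = w + (inner ℝ g N / ‖g‖ ^ 2) • g := by rw [hw]; abel
    rw [this, inner_add_left, inner_smul_left, hgw, real_inner_self_eq_norm_sq]
    simp
  -- Since `w ⊥ g`, the direction `δ • g - w` is admissible for every `δ > 0`; small `δ` then forces
  -- `w = 0`.
  have key : ∀ δ : ℝ, 0 < δ → ‖w‖ ^ 2 ≤ 0 + δ * inner ℝ N g := by
    intro δ hδ
    have h1 : 0 < inner ℝ g (δ • g - w) := by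
      rw [inner_sub_right, inner_smul_right, hgw, real_inner_self_eq_norm_sq]
      nlinarith [mul_pos hδ hg2]
    have h2 := h _ h1
    rw [inner_sub_right, inner_smul_right, hNw] at h2
    linarith
  have h0 : ‖w‖ ^ 2 ≤ 0 := by
    by_contra! hpos
    set K := |inner ℝ N g| + 1
    have hK : 0 < K := by positivity
    have := key (‖w‖ ^ 2 / (2 * K)) (by positivity)
    have h3 : ‖w‖ ^ 2 / (2 * K) * inner ℝ N g ≤ ‖w‖ ^ 2 / (2 * K) * K := by
      gcongr
      exact (le_abs_self _).trans (by simp [K])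
    have h4 : ‖w‖ ^ 2 / (2 * K) * K = ‖w‖ ^ 2 / 2 := by field_simp
    linarith
  have hw0 : w = 0 := by
    have : ‖w‖ = 0 := by nlinarith [norm_nonneg w]
    simpa using this
  exact sub_eq_zero.1 hw0

/-- Directions forming an acute angle with the gradient of a local defining function point
into the set. -/
theorem IsLocalDefiningFunction.exists_add_smul_mem {n : ℕ} {V : Set (EuclideanSpace ℝ (Fin n))}
    {p : EuclideanSpace ℝ (Fin n)} {ρ : EuclideanSpace ℝ (Fin n) → ℝ}
    (h : IsLocalDefiningFunction V p ρ) (hp : p ∈ closure V) {d : EuclideanSpace ℝ (Fin n)}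
    (hd : 0 < inner ℝ (gradient ρ p) d) : ∃ t : ℝ, 0 < t ∧ p + t • d ∈ V := by
  obtain ⟨r, hr, hρ, hne, hV⟩ := h
  have hdiff : DifferentiableAt ℝ ρ p :=
    (hρ.contDiffAt (Metric.ball_mem_nhds p hr)).differentiableAt (by simp)
  have hρp : 0 ≤ ρ p := by
    by_contra! hc
    obtain ⟨x, hxV, hx0, hxr⟩ := ((mem_closure_iff_frequently.1 hp).and_eventually
      ((hdiff.continuousAt.eventually_lt_const hc).and (Metric.ball_mem_nhds p hr))).exists
    exact hx0.not_gt ((hV x hxr).1 hxV)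
  by_contra! hcon
  have hline : HasDerivAt (fun t : ℝ => p + t • d) d 0 := by
    simpa using ((hasDerivAt_id (0 : ℝ)).smul_const d).const_add p
  have hball : ∀ᶠ t : ℝ in nhds 0, p + t • d ∈ Metric.ball p r := by
    apply hline.continuousAt.eventually_mem
    simpa using Metric.ball_mem_nhds p hr
  have hder : HasDerivAt (fun t : ℝ => ρ (p + t • d)) (inner ℝ (gradient ρ p) d) 0 := by
    have h0 : HasFDerivAt ρ (fderiv ℝ ρ p) (p + (0 : ℝ) • d) := by simpa using hdiff.hasFDerivAt
    have := h0.comp_hasDerivAt (0 : ℝ) hline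
    rw [← toDual_gradient (𝕜 := ℝ)] at this
    simpa [Function.comp_def] using this
  obtain ⟨t, ht, hmem, ht0⟩ := ((hder.tendsto_slope_zero_right.eventually_const_lt hd).and
    ((hball.filter_mono nhdsWithin_le_nhds).and self_mem_nhdsWithin)).exists
  have ht0 : 0 < t := ht0
  have hle : ρ (p + t • d) ≤ 0 := not_lt.1 fun hc => hcon t ht0 ((hV _ hmem).2 hc)
  simp only [zero_add, zero_smul, add_zero, smul_eq_mul] at ht
  have := pos_of_mul_pos_right ht (inv_pos.2 ht0).le
  linarith

/-- A point outside the closure of `V` is separated from it by a hyperplane with positive normal. -/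
theorem IsAdmissible.exists_halfspace {n : ℕ} {V : Set (EuclideanSpace ℝ (Fin n))}
    (hV : IsAdmissible V) {m : EuclideanSpace ℝ (Fin n)} (hm : m ∉ closure V) :
    ∃ (N : EuclideanSpace ℝ (Fin n)) (c : ℝ), (∀ i, 0 < N i) ∧ 0 < ∑ i, N i ∧
      inner ℝ N m < c ∧ ∀ y ∈ closure V, c ≤ inner ℝ N y := by
  have hne : (closure V).Nonempty := hV.frontier_nonempty.mono frontier_subset_closure
  have hcv : Convex ℝ (closure V) := hV.convex.closure
  obtain ⟨p, hp, hmin⟩ := exists_norm_eq_iInf_of_complete_convex hne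
    isClosed_closure.isComplete hcv m
  rw [norm_eq_iInf_iff_real_inner_le_zero hcv hp] at hmin
  set N := p - m with hN
  have hN0 : N ≠ 0 := by
    intro h
    rw [hN, sub_eq_zero] at h
    exact hm (h ▸ hp)
  have hNy : ∀ y ∈ closure V, inner ℝ N p ≤ inner ℝ N y := by
    intro y hy
    have := hmin y hy
    rw [← neg_sub p m, inner_neg_left, inner_sub_right] at this
    linarith
  have hNm : inner ℝ N m < inner ℝ N p := by
    have : 0 < inner ℝ N N := real_inner_self_pos.2 hN0
    conv_rhs at this => rw [hN, inner_sub_right]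
    linarith
  -- From a point of the open set `V` one could move along `-N` and get below the minimum of `⟪N,
  -- ·⟫`.
  have hpV : p ∉ V := by
    intro hpV
    have hline : Filter.Tendsto (fun t : ℝ => p - t • N) (nhdsWithin 0 (Ioi 0)) (nhds p) := by
      have : Continuous fun t : ℝ => p - t • N := by fun_prop
      simpa using (this.tendsto 0).mono_left nhdsWithin_le_nhds
    obtain ⟨t, ht, ht0⟩ := ((hline.eventually (hV.isOpen.mem_nhds hpV)).and
      self_mem_nhdsWithin).exists
    have := hNy _ (subset_closure ht)
    rw [inner_sub_right, inner_smul_right, real_inner_self_eq_norm_sq] at this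
    have : 0 < t * ‖N‖ ^ 2 := mul_pos ht0 (by positivity)
    linarith
  have hpf : p ∈ frontier V := by
    rw [frontier, hV.isOpen.interior_eq]
    exact ⟨hp, hpV⟩
  obtain ⟨ρ, hρ⟩ := hV.c1_boundary p hpf
  have hg : gradient ρ p ≠ 0 := by
    obtain ⟨_, _, _, h, _⟩ := hρ
    exact h
  have hpar : N = (inner ℝ (gradient ρ p) N / ‖gradient ρ p‖ ^ 2) • gradient ρ p := by
    refine eq_smul_of_inner_nonneg hg fun d hd => ?_
    obtain ⟨t, ht, htV⟩ := hρ.exists_add_smul_mem hp hd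
    have := hNy _ (subset_closure htV)
    rw [inner_add_right, inner_smul_right] at this
    exact nonneg_of_mul_nonneg_right (by linarith) ht
  have hgi : ∀ i, 0 < gradient ρ p i := by
    intro i
    have := hV.normal_pos p hpf _ ⟨ρ, hρ, rfl⟩ i
    have h1 : 0 < ‖gradient ρ p‖⁻¹ := by positivity
    exact pos_of_mul_pos_right (by simpa using this) h1.le
  have hk : 0 < inner ℝ (gradient ρ p) N / ‖gradient ρ p‖ ^ 2 := by
    have hk0 : 0 ≤ inner ℝ (gradient ρ p) N := by
      obtain ⟨t, ht, htV⟩ := hρ.exists_add_smul_mem hp (real_inner_self_pos.2 hg)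
      have := hNy _ (subset_closure htV)
      rw [inner_add_right, inner_smul_right, real_inner_comm (gradient ρ p) N] at this
      exact nonneg_of_mul_nonneg_right (by linarith) ht
    refine lt_of_le_of_ne (by positivity) fun h => hN0 ?_
    rw [hpar, ← h, zero_smul]
  have hNi : ∀ i, 0 < N i := by
    intro i
    rw [hpar]
    simpa using mul_pos hk (hgi i)
  refine ⟨N, inner ℝ N p, hNi, ?_, hNm, hNy⟩
  refine Finset.sum_pos (fun i _ => hNi i) ?_
  -- For `n = 0` the space is trivial, contradicting `N ≠ 0`.
  by_contra hemp
  rw [Finset.not_nonempty_iff_eq_empty, Finset.univ_eq_empty_iff] at hemp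
  exact hN0 (Subsingleton.elim _ _)

/-! ### From eigenvalue vectors to matrices -/

/-- A convex permutation-invariant set is invariant under doubly stochastic matrices. -/
theorem Convex.doublyStochastic_mulVec_mem {n : ℕ} {C : Set (EuclideanSpace ℝ (Fin n))}
    (hC : Convex ℝ C)
    (hsymm : ∀ (σ : Equiv.Perm (Fin n)) (l : EuclideanSpace ℝ (Fin n)),
      l ∈ C → WithLp.toLp 2 (fun i => l (σ i)) ∈ C)
    {S : Matrix (Fin n) (Fin n) ℝ} (hS : S ∈ doublyStochastic ℝ (Fin n))
    {l : EuclideanSpace ℝ (Fin n)} (hl : l ∈ C) : WithLp.toLp 2 (S.mulVec l) ∈ C := by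
  obtain ⟨w, hw0, hw1, rfl⟩ := exists_eq_sum_perm_of_mem_doublyStochastic hS
  have : WithLp.toLp 2 ((∑ σ, w σ • σ.permMatrix ℝ).mulVec l) =
      ∑ σ, w σ • (WithLp.toLp 2 (fun i => l (σ i)) : EuclideanSpace ℝ (Fin n)) := by
    ext i
    simp [Matrix.sum_mulVec, Matrix.smul_mulVec, Matrix.permMatrix_mulVec]
  rw [this]
  exact hC.sum_mem (fun σ _ => hw0 σ) hw1 fun σ _ => hsymm σ l hl

theorem IsAdmissible.perm_mem_closure {n : ℕ} {V : Set (EuclideanSpace ℝ (Fin n))}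
    (hV : IsAdmissible V) (σ : Equiv.Perm (Fin n)) (l : EuclideanSpace ℝ (Fin n))
    (hl : l ∈ closure V) : WithLp.toLp 2 (fun i => l (σ i)) ∈ closure V := by
  have hc : Continuous fun l : EuclideanSpace ℝ (Fin n) =>
      (WithLp.toLp 2 (fun i => l (σ i)) : EuclideanSpace ℝ (Fin n)) := by fun_prop
  exact (Set.MapsTo.closure (fun l hl => hV.symmetric σ l hl) hc) hl

/-- The squares of the entries of a change of orthonormal basis form a doubly stochastic
matrix. -/
theorem sq_inner_mem_doublyStochastic {n : ℕ}
    (b w : OrthonormalBasis (Fin n) ℝ (EuclideanSpace ℝ (Fin n))) :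
    (Matrix.of fun k j => inner ℝ (b k) (w j) ^ 2) ∈ doublyStochastic ℝ (Fin n) := by
  rw [mem_doublyStochastic_iff_sum]
  refine ⟨fun i j => sq_nonneg _, fun i => ?_, fun j => ?_⟩
  · have := w.sum_sq_inner_left (b i)
    simpa [real_inner_comm] using this
  · have := b.sum_sq_inner_left (w j)
    simpa [real_inner_comm] using this

/-- The quadratic form of a symmetric matrix in terms of its eigenvalues. -/
theorem quadForm_eq_sum_eigenvalues {n : ℕ} {M : Matrix (Fin n) (Fin n) ℝ} (hM : M.IsHermitian)
    (x : EuclideanSpace ℝ (Fin n)) :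
    x ⬝ᵥ M.mulVec x = ∑ j, inner ℝ x (hM.eigenvectorBasis j) ^ 2 * hM.eigenvalues j := by
  set w := hM.eigenvectorBasis
  have hdot : ∀ y : EuclideanSpace ℝ (Fin n), x ⬝ᵥ y = inner ℝ x y := fun y => by
    rw [real_inner_comm]
    simp [PiLp.inner_apply, dotProduct]
  have hx : (x : Fin n → ℝ) = ∑ j, inner ℝ x (w j) • (w j : Fin n → ℝ) := by
    conv_lhs => rw [← w.sum_repr' x]
    simp [real_inner_comm]
  calc x ⬝ᵥ M.mulVec x = x ⬝ᵥ M.mulVec (∑ j, inner ℝ x (w j) • (w j : Fin n → ℝ)) := by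
        rw [← hx]
    _ = ∑ j, inner ℝ x (w j) ^ 2 * hM.eigenvalues j := by
        rw [Matrix.mulVec_sum, dotProduct_sum]
        refine Finset.sum_congr rfl fun j _ => ?_
        rw [Matrix.mulVec_smul, hM.mulVec_eigenvectorBasis, dotProduct_smul, dotProduct_smul,
          hdot]
        simp only [smul_eq_mul]
        ring


/-- A symmetric matrix with eigenvalues outside the closure of `V` is separated from the matrices
with eigenvalues in the closure by a positive definite linear functional. -/
theorem IsAdmissible.exists_linear_bound {n : ℕ} {V : Set (EuclideanSpace ℝ (Fin n))}
    (hV : IsAdmissible V) {M₀ : Matrix (Fin n) (Fin n) ℝ} (hM₀ : M₀.IsHermitian)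
    (h₀ : eigenvalueVector M₀ ∉ closure V) :
    ∃ (N : Fin n → ℝ) (b : OrthonormalBasis (Fin n) ℝ (EuclideanSpace ℝ (Fin n))) (c : ℝ),
      (∀ i, 0 < N i) ∧ 0 < ∑ i, N i ∧ ∑ k, N k * (b k ⬝ᵥ M₀.mulVec (b k)) < c ∧
      ∀ M : Matrix (Fin n) (Fin n) ℝ, M.IsHermitian → eigenvalueVector M ∈ closure V →
        c ≤ ∑ k, N k * (b k ⬝ᵥ M.mulVec (b k)) := by
  obtain ⟨N, c, hN, hN', hlt, hle⟩ := hV.exists_halfspace h₀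
  refine ⟨N, hM₀.eigenvectorBasis, c, hN, hN', ?_, fun M hM hMV => ?_⟩
  · rw [eigenvalueVector_of_isHermitian hM₀] at hlt
    convert hlt using 1
    rw [PiLp.inner_apply]
    refine Finset.sum_congr rfl fun k _ => ?_
    rw [quadForm_eq_sum_eigenvalues hM₀]
    simp [orthonormal_iff_ite.1 hM₀.eigenvectorBasis.orthonormal, mul_comm]
  · rw [eigenvalueVector_of_isHermitian hM] at hMV
    -- The vector tested here is the diagonal of `M` in the eigenbasis of `M₀`.
    have := hle _ (Convex.doublyStochastic_mulVec_mem hV.convex.closure hV.perm_mem_closure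
      (sq_inner_mem_doublyStochastic hM₀.eigenvectorBasis hM.eigenvectorBasis) hMV)
    convert this using 1
    rw [PiLp.inner_apply]
    refine Finset.sum_congr rfl fun k _ => ?_
    rw [quadForm_eq_sum_eigenvalues hM]
    simp [Matrix.mulVec, dotProduct, mul_comm]


/-! ### Constant coefficient operators and the second derivative test -/

section Calculus

variable {F : Type*} [NormedAddCommGroup F] [NormedSpace ℝ F] {ι : Type*} [Fintype ι]

/-- The constant coefficient operator `∑ₖ Nₖ ∂²f/∂bₖ²`. -/
def dirOp (N : ι → ℝ) (b : ι → F) (f : F → ℝ) (x : F) : ℝ :=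
  ∑ k, N k * fderiv ℝ (fderiv ℝ f) x (b k) (b k)

theorem ContDiffAt.eventually_differentiableAt {f : F → ℝ} {x : F} (hf : ContDiffAt ℝ 2 f x) :
    ∀ᶠ y in nhds x, DifferentiableAt ℝ f y :=
  (hf.eventually (by simp)).mono fun _ hy => hy.differentiableAt (by simp)

theorem ContDiffAt.differentiableAt_fderiv {f : F → ℝ} {x : F} (hf : ContDiffAt ℝ 2 f x) :
    DifferentiableAt ℝ (fderiv ℝ f) x :=
  (hf.fderiv_right (m := 1) (by norm_num)).differentiableAt (by simp)

theorem fderiv_fderiv_add {f g : F → ℝ} {x : F} (hf : ContDiffAt ℝ 2 f x)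
    (hg : ContDiffAt ℝ 2 g x) :
    fderiv ℝ (fderiv ℝ (fun y => f y + g y)) x =
      fderiv ℝ (fderiv ℝ f) x + fderiv ℝ (fderiv ℝ g) x := by
  have : fderiv ℝ (fun y => f y + g y) =ᶠ[nhds x] fun y => fderiv ℝ f y + fderiv ℝ g y := by
    filter_upwards [ContDiffAt.eventually_differentiableAt hf,
      ContDiffAt.eventually_differentiableAt hg] with y h1 h2
    exact fderiv_fun_add h1 h2
  rw [this.fderiv_eq]
  exact fderiv_fun_add (ContDiffAt.differentiableAt_fderiv hf)
    (ContDiffAt.differentiableAt_fderiv hg)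

theorem fderiv_fderiv_const_mul {f : F → ℝ} {x : F} (hf : ContDiffAt ℝ 2 f x) (c : ℝ) :
    fderiv ℝ (fderiv ℝ (fun y => c * f y)) x = c • fderiv ℝ (fderiv ℝ f) x := by
  have : fderiv ℝ (fun y => c * f y) =ᶠ[nhds x] fun y => c • fderiv ℝ f y := by
    filter_upwards [ContDiffAt.eventually_differentiableAt hf] with y h1
    exact fderiv_const_mul h1 c
  rw [this.fderiv_eq]
  exact fderiv_fun_const_smul (ContDiffAt.differentiableAt_fderiv hf) c

variable {N : ι → ℝ} {b : ι → F}

theorem dirOp_add {f g : F → ℝ} {x : F} (hf : ContDiffAt ℝ 2 f x) (hg : ContDiffAt ℝ 2 g x) :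
    dirOp N b (fun y => f y + g y) x = dirOp N b f x + dirOp N b g x := by
  simp [dirOp, fderiv_fderiv_add hf hg, mul_add, Finset.sum_add_distrib]

theorem dirOp_const_mul {f : F → ℝ} {x : F} (hf : ContDiffAt ℝ 2 f x) (c : ℝ) :
    dirOp N b (fun y => c * f y) x = c * dirOp N b f x := by
  simp [dirOp, fderiv_fderiv_const_mul hf c, Finset.mul_sum, mul_left_comm]

theorem dirOp_const (c : ℝ) (x : F) : dirOp N b (fun _ => c) x = 0 := by
  have : fderiv ℝ (fun _ : F => c) = fun _ => 0 := by
    ext1 y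
    simp
  simp [dirOp, this]

theorem dirOp_sub {f g : F → ℝ} {x : F} (hf : ContDiffAt ℝ 2 f x) (hg : ContDiffAt ℝ 2 g x) :
    dirOp N b (fun y => f y - g y) x = dirOp N b f x - dirOp N b g x := by
  have h := dirOp_add (N := N) (b := b) hf (contDiffAt_const.mul hg : ContDiffAt ℝ 2
    (fun y => (-1 : ℝ) * g y) x)
  rw [dirOp_const_mul hg] at h
  simpa [sub_eq_add_neg] using h

theorem dirOp_congr {f g : F → ℝ} {x : F} (h : f =ᶠ[nhds x] g) :
    dirOp N b f x = dirOp N b g x := by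
  simp only [dirOp, h.fderiv.fderiv_eq]

theorem continuousAt_dirOp {f : F → ℝ} {x : F} (hf : ContDiffAt ℝ 2 f x) :
    ContinuousAt (dirOp N b f) x := by
  have h1 : ContinuousAt (fderiv ℝ (fderiv ℝ f)) x :=
    ((hf.fderiv_right (m := 1) (by norm_num)).fderiv_right (m := 0) (by simp)).continuousAt
  unfold dirOp
  fun_prop

/-- The second-order necessary condition at a local maximum. -/
theorem IsLocalMax.fderiv_fderiv_apply_nonpos {f : F → ℝ} {x : F} (h : IsLocalMax f x)
    (hf : ContDiffAt ℝ 2 f x) (v : F) : fderiv ℝ (fderiv ℝ f) x v v ≤ 0 := by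
  have hline : ∀ t : ℝ, HasDerivAt (fun t : ℝ => x + t • v) v t := fun t => by
    simpa using ((hasDerivAt_id t).smul_const v).const_add x
  have htend : Filter.Tendsto (fun t : ℝ => x + t • v) (nhds 0) (nhds x) := by
    simpa [ContinuousAt] using (hline 0).continuousAt
  set g : ℝ → ℝ := fun t => f (x + t • v) with hg
  have hg1 : deriv g =ᶠ[nhds 0] fun t => fderiv ℝ f (x + t • v) v := by
    filter_upwards [htend.eventually (ContDiffAt.eventually_differentiableAt hf)] with t ht
    exact (ht.hasFDerivAt.comp_hasDerivAt t (hline t)).deriv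
  have hg2 : deriv (deriv g) 0 = fderiv ℝ (fderiv ℝ f) x v v := by
    rw [hg1.deriv_eq]
    have h2 : HasFDerivAt (fderiv ℝ f) (fderiv ℝ (fderiv ℝ f) x) (x + (0 : ℝ) • v) := by
      simpa using (ContDiffAt.differentiableAt_fderiv hf).hasFDerivAt
    have h3 := h2.comp_hasDerivAt (0 : ℝ) (hline 0)
    simpa using (h3.clm_apply (hasDerivAt_const (0 : ℝ) v)).deriv
  have hmax : IsLocalMax g 0 := by
    have := htend.eventually h
    simpa [IsLocalMax, IsMaxFilter, hg] using this
  -- A positive second derivative would make `0` a local minimum as well, so `g` would be locally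
  -- constant.
  by_contra! hpos
  rw [← hg2] at hpos
  have hcont : ContinuousAt g 0 :=
    ContinuousAt.comp (g := f) (by simpa using hf.continuousAt) (hline 0).continuousAt
  have hmin : IsLocalMin g 0 := isLocalMin_of_deriv_deriv_pos hpos hmax.deriv_eq_zero hcont
  have hconst : g =ᶠ[nhds 0] fun _ => g 0 := by
    filter_upwards [hmax, hmin] with t h1 h2
    exact le_antisymm h1 h2
  rw [hconst.deriv.deriv_eq] at hpos
  simp at hpos

theorem dirOp_le_of_isLocalMax_sub {f g : F → ℝ} {x : F} (hN : ∀ k, 0 ≤ N k)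
    (hf : ContDiffAt ℝ 2 f x) (hg : ContDiffAt ℝ 2 g x)
    (h : IsLocalMax (fun y => f y - g y) x) : dirOp N b f x ≤ dirOp N b g x := by
  rw [← sub_nonpos, ← dirOp_sub hf hg]
  exact Finset.sum_nonpos fun k _ => mul_nonpos_of_nonneg_of_nonpos (hN k)
    (IsLocalMax.fderiv_fderiv_apply_nonpos h (hf.sub hg) _)

/-- `u` is a viscosity subsolution of `dirOp N b u ≥ c` in `U`, tested locally. -/
def IsLocalSubsolution (N : ι → ℝ) (b : ι → F) (c : ℝ) (U : Set F) (u : F → ℝ) : Prop :=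
  ∀ x ∈ U, ∀ ψ : F → ℝ, ContDiffAt ℝ 2 ψ x → (∀ᶠ y in nhds x, u y ≤ ψ y) → u x = ψ x →
    c ≤ dirOp N b ψ x

/-- At a contact point `u - ψ` has a local maximum, and nonnegative weights turn the second
derivative test into an inequality for `dirOp`. This lets classical solutions enter the comparison
principle. -/
theorem isLocalSubsolution_of_contDiffAt (hN : ∀ k, 0 ≤ N k) {c : ℝ} {U : Set F} {u : F → ℝ}
    (hu : ∀ x ∈ U, ContDiffAt ℝ 2 u x) (hc : ∀ x ∈ U, c ≤ dirOp N b u x) :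
    IsLocalSubsolution N b c U u := by
  intro x hx ψ hψ hle heq
  refine (hc x hx).trans (dirOp_le_of_isLocalMax_sub hN (hu x hx) hψ ?_)
  filter_upwards [hle] with y hy
  linarith

end Calculus

/-! ### Comparison principle on balls -/

section Comparison

variable {F : Type*} [NormedAddCommGroup F] [InnerProductSpace ℝ F] {ι : Type*} [Fintype ι]
  {N : ι → ℝ}

theorem dirOp_norm_sub_sq (b : ι → F) (x₀ x : F) :
    dirOp N b (fun y => ‖y - x₀‖ ^ 2) x = ∑ k, N k * (2 * ‖b k‖ ^ 2) := by
  have h1 : fderiv ℝ (fun y : F => ‖y - x₀‖ ^ 2) = fun y => 2 • innerSL ℝ (y - x₀) := by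
    ext1 y
    have := (hasStrictFDerivAt_norm_sq (y - x₀)).hasFDerivAt.comp y
      ((hasFDerivAt_id y).sub_const x₀)
    simpa [Function.comp_def] using this.fderiv
  have h2 : HasFDerivAt (fun y : F => 2 • innerSL ℝ (y - x₀)) (2 • innerSL ℝ) x := by
    have h3 : HasFDerivAt (fun y : F => innerSL ℝ (y - x₀)) (innerSL ℝ) x := by
      exact (innerSL ℝ (E := F)).hasFDerivAt.comp x ((hasFDerivAt_id x).sub_const x₀)
    exact h3.const_smul 2
  simp only [dirOp, h1, h2.fderiv]
  refine Finset.sum_congr rfl fun k _ => ?_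
  have : innerSL ℝ (b k) (b k) = ‖b k‖ ^ 2 := real_inner_self_eq_norm_sq (b k)
  simp [this]

/-- Comparison of local subsolutions with classical supersolutions on a ball. -/
theorem IsLocalSubsolution.le_of_le_on_sphere [ProperSpace F] {b : OrthonormalBasis ι ℝ F}
    (hN : 0 < ∑ k, N k) {c r : ℝ} {x₀ : F} {u h : F → ℝ}
    (hu : IsLocalSubsolution N b c (Metric.ball x₀ r) u)
    (huc : ContinuousOn u (Metric.closedBall x₀ r))
    (hhc : ContinuousOn h (Metric.closedBall x₀ r))
    (hh : ∀ x ∈ Metric.ball x₀ r, ContDiffAt ℝ 2 h x)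
    (hc : ∀ x ∈ Metric.ball x₀ r, dirOp N b h x ≤ c)
    (hle : ∀ x ∈ Metric.sphere x₀ r, u x ≤ h x) {z : F} (hz : z ∈ Metric.ball x₀ r) :
    u z ≤ h z := by
  by_contra! hlt
  have hr : 0 < r := Metric.pos_of_mem_ball hz
  -- Subtracting `ε‖y - x₀‖²` from `h` makes the supersolution strict. Here `ε * r ^ 2` is half the
  -- gap at `z`, too little for the maximum to move to the sphere.
  set ε := (u z - h z) / (2 * r ^ 2) with hε
  have hε0 : 0 < ε := by have := sub_pos.2 hlt; positivity
  have hεr : ε * r ^ 2 < u z - h z := by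
    rw [hε]
    field_simp
    linarith
  obtain ⟨x₁, hx₁, hmax⟩ := (isCompact_closedBall x₀ r).exists_isMaxOn
    ⟨z, Metric.ball_subset_closedBall hz⟩
    (f := fun x => u x - (h x - ε * ‖x - x₀‖ ^ 2))
    (huc.sub (hhc.sub (by fun_prop)))
  have hmax' : ∀ y ∈ Metric.closedBall x₀ r,
      u y - (h y - ε * ‖y - x₀‖ ^ 2) ≤ u x₁ - (h x₁ - ε * ‖x₁ - x₀‖ ^ 2) := hmax
  have hx₁b : x₁ ∈ Metric.ball x₀ r := by
    by_contra hnb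
    have hs : ‖x₁ - x₀‖ = r := by
      rw [← dist_eq_norm]
      exact le_antisymm hx₁ (not_lt.1 hnb)
    have h1 := hmax' z (Metric.ball_subset_closedBall hz)
    have h2 := hle x₁ (by rw [Metric.mem_sphere, dist_eq_norm, hs])
    rw [hs] at h1
    have : 0 ≤ ε * ‖z - x₀‖ ^ 2 := by positivity
    linarith
  set m := u x₁ - (h x₁ - ε * ‖x₁ - x₀‖ ^ 2)
  have hq : ContDiffAt ℝ 2 (fun y : F => ε * ‖y - x₀‖ ^ 2) x₁ :=
    contDiffAt_const.mul ((contDiffAt_id.sub contDiffAt_const).norm_sq ℝ)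
  have hq' : ContDiffAt ℝ 2 (fun y : F => ‖y - x₀‖ ^ 2) x₁ :=
    (contDiffAt_id.sub contDiffAt_const).norm_sq ℝ
  have key := hu x₁ hx₁b (fun y => (h y - ε * ‖y - x₀‖ ^ 2) + m)
    (((hh x₁ hx₁b).sub hq).add contDiffAt_const) ?_ (by simp [m])
  · rw [dirOp_add ((hh x₁ hx₁b).sub hq) contDiffAt_const, dirOp_const,
      dirOp_sub (hh x₁ hx₁b) hq, dirOp_const_mul hq', dirOp_norm_sub_sq] at key
    have h1 := hc x₁ hx₁b
    simp only [b.orthonormal.1, ← Finset.sum_mul] at key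
    have : 0 < ε * ((∑ k, N k) * (2 * 1 ^ 2)) := by positivity
    linarith
  · filter_upwards [Metric.isOpen_ball.mem_nhds hx₁b] with y hy
    have := hmax' y (Metric.ball_subset_closedBall hy)
    linarith

end Comparison


/-! ### Dirichlet problem with polynomial data -/

section PolynomialDirichlet

variable {n : ℕ}

/-- The directional derivative of a polynomial. -/
def dirDeriv (v : EuclideanSpace ℝ (Fin n)) :
    MvPolynomial (Fin n) ℝ →ₗ[ℝ] MvPolynomial (Fin n) ℝ :=
  ∑ i, v i • (MvPolynomial.pderiv i).toLinearMap

/-- `dirOp` on polynomials. -/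
def polyOp {ι : Type*} [Fintype ι] (N : ι → ℝ) (b : ι → EuclideanSpace ℝ (Fin n)) :
    MvPolynomial (Fin n) ℝ →ₗ[ℝ] MvPolynomial (Fin n) ℝ :=
  ∑ k, N k • (dirDeriv (b k) ∘ₗ dirDeriv (b k))

theorem analyticOnNhd_eval (p : MvPolynomial (Fin n) ℝ) :
    AnalyticOnNhd ℝ (fun x : EuclideanSpace ℝ (Fin n) => MvPolynomial.eval x p) univ :=
  AnalyticOnNhd.eval_continuousLinearMap
    (EuclideanSpace.equiv (Fin n) ℝ : EuclideanSpace ℝ (Fin n) →L[ℝ] Fin n → ℝ) p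

theorem contDiff_eval (p : MvPolynomial (Fin n) ℝ) :
    ContDiff ℝ 2 (fun x : EuclideanSpace ℝ (Fin n) => MvPolynomial.eval x p) :=
  contDiffOn_univ.1 (analyticOnNhd_eval p).contDiffOn_of_completeSpace

theorem fderiv_eval (p : MvPolynomial (Fin n) ℝ) (x v : EuclideanSpace ℝ (Fin n)) :
    fderiv ℝ (fun x : EuclideanSpace ℝ (Fin n) => MvPolynomial.eval x p) x v =
      MvPolynomial.eval x (dirDeriv v p) := by
  have hd : ∀ q : MvPolynomial (Fin n) ℝ, DifferentiableAt ℝ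
      (fun x : EuclideanSpace ℝ (Fin n) => MvPolynomial.eval x q) x := fun q =>
    (contDiff_eval q).contDiffAt.differentiableAt (by simp)
  induction p using MvPolynomial.induction_on with
  | C a => simp [dirDeriv]
  | add p q hp hq =>
    simp only [map_add]
    rw [fderiv_fun_add (hd p) (hd q), ← hp, ← hq]
    rfl
  | mul_X p i hp =>
    have hX : HasFDerivAt (fun x : EuclideanSpace ℝ (Fin n) => x i)
        (EuclideanSpace.proj i : EuclideanSpace ℝ (Fin n) →L[ℝ] ℝ) x :=
      (EuclideanSpace.proj i : EuclideanSpace ℝ (Fin n) →L[ℝ] ℝ).hasFDerivAt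
    have := ((hd p).hasFDerivAt.mul hX).fderiv
    simp only [map_mul, MvPolynomial.eval_X]
    have h2 : (fun x : EuclideanSpace ℝ (Fin n) => MvPolynomial.eval x p * x i) =
      (fun x : EuclideanSpace ℝ (Fin n) => MvPolynomial.eval x p) * fun x => x i := rfl
    rw [h2, this]
    simp only [add_apply, smul_apply, hp]
    simp [dirDeriv, MvPolynomial.pderiv_X, Pi.single_apply, Finset.sum_add_distrib,
      Finset.mul_sum, mul_left_comm, mul_comm, apply_ite]

theorem dirOp_eval {ι : Type*} [Fintype ι] (N : ι → ℝ) (b : ι → EuclideanSpace ℝ (Fin n))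
    (p : MvPolynomial (Fin n) ℝ) (x : EuclideanSpace ℝ (Fin n)) :
    dirOp N b (fun x => MvPolynomial.eval x p) x = MvPolynomial.eval x (polyOp N b p) := by
  have key : ∀ v : EuclideanSpace ℝ (Fin n),
      fderiv ℝ (fderiv ℝ (fun x : EuclideanSpace ℝ (Fin n) => MvPolynomial.eval x p)) x v v =
      MvPolynomial.eval x (dirDeriv v (dirDeriv v p)) := by
    intro v
    have h1 := ContDiffAt.differentiableAt_fderiv ((contDiff_eval p).contDiffAt (x := x))
    have h2 := (h1.hasFDerivAt.clm_apply (hasFDerivAt_const v x)).fderiv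
    have h3 := fderiv_eval (dirDeriv v p) x v
    rw [← h3]
    simp only [← fderiv_eval]
    rw [h2]
    simp
  simp [dirOp, key, polyOp]

theorem totalDegree_pderiv_le (p : MvPolynomial (Fin n) ℝ) (i : Fin n) (d : ℕ)
    (hp : p.totalDegree ≤ d + 1) : (MvPolynomial.pderiv i p).totalDegree ≤ d := by
  refine Finset.sup_le fun s hs => ?_
  rw [MvPolynomial.mem_support_iff, MvPolynomial.coeff_pderiv] at hs
  have h1 := (MvPolynomial.le_totalDegree
    (MvPolynomial.mem_support_iff.2 (left_ne_zero_of_mul hs))).trans hp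
  rw [Finsupp.sum_add_index' (by simp) (by simp)] at h1
  simpa using h1

theorem totalDegree_dirDeriv_le (p : MvPolynomial (Fin n) ℝ) (v : EuclideanSpace ℝ (Fin n))
    (d : ℕ) (hp : p.totalDegree ≤ d + 1) : (dirDeriv v p).totalDegree ≤ d := by
  rw [← MvPolynomial.mem_restrictTotalDegree]
  simp only [dirDeriv, LinearMap.sum_apply, LinearMap.smul_apply]
  refine Submodule.sum_mem _ fun i _ => Submodule.smul_mem _ _ ?_
  rw [MvPolynomial.mem_restrictTotalDegree]
  exact totalDegree_pderiv_le p i d hp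

theorem totalDegree_polyOp_le {ι : Type*} [Fintype ι] (N : ι → ℝ)
    (b : ι → EuclideanSpace ℝ (Fin n)) (p : MvPolynomial (Fin n) ℝ)
    (d : ℕ) (hp : p.totalDegree ≤ d + 2) : (polyOp N b p).totalDegree ≤ d := by
  rw [← MvPolynomial.mem_restrictTotalDegree]
  simp only [polyOp, LinearMap.sum_apply, LinearMap.smul_apply]
  refine Submodule.sum_mem _ fun i _ => Submodule.smul_mem _ _ ?_
  rw [MvPolynomial.mem_restrictTotalDegree]
  exact totalDegree_dirDeriv_le _ _ d (totalDegree_dirDeriv_le _ _ _ hp)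

/-- The polynomial `r² - |x - x₀|²`. -/
def spherePoly (x₀ : EuclideanSpace ℝ (Fin n)) (r : ℝ) : MvPolynomial (Fin n) ℝ :=
  MvPolynomial.C (r ^ 2) - ∑ i, (MvPolynomial.X i - MvPolynomial.C (x₀ i)) ^ 2

theorem eval_spherePoly (x₀ x : EuclideanSpace ℝ (Fin n)) (r : ℝ) :
    MvPolynomial.eval x (spherePoly x₀ r) = r ^ 2 - ‖x - x₀‖ ^ 2 := by
  simp [spherePoly, EuclideanSpace.norm_sq_eq]

theorem totalDegree_spherePoly_le (x₀ : EuclideanSpace ℝ (Fin n)) (r : ℝ) :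
    (spherePoly x₀ r).totalDegree ≤ 2 := by
  rw [← MvPolynomial.mem_restrictTotalDegree, spherePoly]
  refine Submodule.sub_mem _ ?_ (Submodule.sum_mem _ fun i _ => ?_)
  · rw [MvPolynomial.mem_restrictTotalDegree, MvPolynomial.totalDegree_C]
    exact Nat.zero_le _
  · rw [MvPolynomial.mem_restrictTotalDegree]
    refine (MvPolynomial.totalDegree_pow _ _).trans ?_
    have := MvPolynomial.totalDegree_sub (MvPolynomial.X i) (MvPolynomial.C (x₀ i))
    simp at this
    omega

variable {N : Fin n → ℝ} (b : OrthonormalBasis (Fin n) ℝ (EuclideanSpace ℝ (Fin n)))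

/-- The product vanishes on the sphere, so comparison with `0`, applied to `q` and `-q`, makes it
vanish in the ball. The sphere polynomial is positive there, so `q` is zero on an open set, hence
everywhere by analyticity. -/
theorem eq_zero_of_polyOp_spherePoly_mul_eq_zero (hN : ∀ k, 0 ≤ N k) (hN' : 0 < ∑ k, N k)
    (x₀ : EuclideanSpace ℝ (Fin n)) {r : ℝ} (hr : 0 < r) {q : MvPolynomial (Fin n) ℝ}
    (hq : polyOp N b (spherePoly x₀ r * q) = 0) : q = 0 := by
  have aux : ∀ p : MvPolynomial (Fin n) ℝ, polyOp N b (spherePoly x₀ r * p) = 0 →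
      ∀ z ∈ Metric.ball x₀ r, MvPolynomial.eval z p ≤ 0 := by
    intro p hp z hz
    have hsub : IsLocalSubsolution N b 0 (Metric.ball x₀ r)
        (fun x => MvPolynomial.eval x (spherePoly x₀ r * p)) :=
      isLocalSubsolution_of_contDiffAt hN (fun x _ => (contDiff_eval _).contDiffAt)
        fun x _ => by rw [dirOp_eval, hp, map_zero]
    have h1 := hsub.le_of_le_on_sphere (h := fun _ => 0) hN'
      (contDiff_eval _).continuous.continuousOn continuousOn_const
      (fun _ _ => contDiffAt_const) (fun x _ => by rw [dirOp_const])
      (fun x hx => by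
        rw [mem_sphere_iff_norm] at hx
        simp [eval_spherePoly, hx]) hz
    have h2 : 0 < r ^ 2 - ‖z - x₀‖ ^ 2 := by
      rw [mem_ball_iff_norm] at hz
      nlinarith [norm_nonneg (z - x₀)]
    rw [map_mul, eval_spherePoly] at h1
    exact nonpos_of_mul_nonpos_right h1 h2
  have hzero : ∀ z ∈ Metric.ball x₀ r, MvPolynomial.eval z q = 0 := by
    intro z hz
    refine le_antisymm (aux q hq z hz) ?_
    have := aux (-q) (by rw [mul_neg, map_neg, hq, neg_zero]) z hz
    simpa using this
  have hall := (analyticOnNhd_eval q).eqOn_of_preconnected_of_eventuallyEq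
    (analyticOnNhd_const (v := (0 : ℝ))) isPreconnected_univ (mem_univ x₀)
    (Filter.eventuallyEq_of_mem (Metric.ball_mem_nhds x₀ hr) hzero)
  refine MvPolynomial.funext fun x => ?_
  simpa using hall (mem_univ (WithLp.toLp 2 x))

/-- The Dirichlet problem for `dirOp` on a ball with polynomial boundary data. -/
theorem exists_polynomial_dirichlet (hN : ∀ k, 0 ≤ N k) (hN' : 0 < ∑ k, N k)
    (x₀ : EuclideanSpace ℝ (Fin n)) {r : ℝ} (hr : 0 < r) (c : ℝ)
    (p : MvPolynomial (Fin n) ℝ) :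
    ∃ h : MvPolynomial (Fin n) ℝ, (∀ x, dirOp N b (fun x => MvPolynomial.eval x h) x = c) ∧
      ∀ x ∈ Metric.sphere x₀ r, MvPolynomial.eval x h = MvPolynomial.eval x p := by
  set d := p.totalDegree
  set W := MvPolynomial.restrictTotalDegree (Fin n) ℝ d
  -- Seek the solution as `p + spherePoly x₀ r * q`. The factor raises the degree by at most two and
  -- `polyOp` lowers it by two, so `T₀` preserves the finite-dimensional `W`, where injectivity
  -- gives surjectivity.
  let T₀ : MvPolynomial (Fin n) ℝ →ₗ[ℝ] MvPolynomial (Fin n) ℝ :=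
    polyOp N b ∘ₗ LinearMap.mulLeft ℝ (spherePoly x₀ r)
  have hT : ∀ q ∈ W, T₀ q ∈ W := by
    intro q hq
    rw [MvPolynomial.mem_restrictTotalDegree] at hq ⊢
    refine totalDegree_polyOp_le _ _ _ _ ((MvPolynomial.totalDegree_mul _ _).trans ?_)
    have := totalDegree_spherePoly_le x₀ r
    omega
  have hinj : Function.Injective (T₀.restrict hT) := by
    rw [injective_iff_map_eq_zero]
    intro q hq
    exact Subtype.ext (eq_zero_of_polyOp_spherePoly_mul_eq_zero b hN hN' x₀ hr
      (congrArg Subtype.val hq))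
  have hmem : MvPolynomial.C c - polyOp N b p ∈ W := by
    refine Submodule.sub_mem _ ?_ ?_ <;> rw [MvPolynomial.mem_restrictTotalDegree]
    · simp
    · exact totalDegree_polyOp_le _ _ _ _ (by omega)
  obtain ⟨q, hq⟩ := LinearMap.injective_iff_surjective.1 hinj ⟨_, hmem⟩
  have hq' : polyOp N b (spherePoly x₀ r * q) = MvPolynomial.C c - polyOp N b p :=
    congrArg Subtype.val hq
  refine ⟨p + spherePoly x₀ r * q, fun x => ?_, fun x hx => ?_⟩
  · rw [dirOp_eval, map_add, hq']
    simp
  · rw [mem_sphere_iff_norm] at hx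
    simp [eval_spherePoly, hx]

/-- Polynomials are uniformly dense in the continuous functions on a compact set. -/
theorem exists_polynomial_near {K : Set (EuclideanSpace ℝ (Fin n))} (hK : IsCompact K)
    {f : EuclideanSpace ℝ (Fin n) → ℝ} (hf : ContinuousOn f K) {ε : ℝ} (hε : 0 < ε) :
    ∃ p : MvPolynomial (Fin n) ℝ, ∀ x ∈ K, |MvPolynomial.eval x p - f x| < ε := by
  have : CompactSpace K := isCompact_iff_compactSpace.1 hK
  let X : Fin n → C(K, ℝ) := fun i => ⟨fun x => (x : EuclideanSpace ℝ (Fin n)) i, by fun_prop⟩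
  have hX : ∀ (p : MvPolynomial (Fin n) ℝ) (x : K),
      MvPolynomial.aeval X p x = MvPolynomial.eval (x : EuclideanSpace ℝ (Fin n)) p := by
    intro p x
    induction p using MvPolynomial.induction_on with
    | C a => simp
    | add p q hp hq => simp [hp, hq]
    | mul_X p i hp => simp [hp, X]
  obtain ⟨⟨g, p, rfl⟩, hg⟩ :=
    ContinuousMap.exists_mem_subalgebra_near_continuousMap_of_separatesPoints
    (MvPolynomial.aeval X).range (fun x y hxy => by
      have : ∃ i, (x : EuclideanSpace ℝ (Fin n)) i ≠ (y : EuclideanSpace ℝ (Fin n)) i := by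
        by_contra! h
        exact hxy (Subtype.ext (PiLp.ext h))
      obtain ⟨i, hi⟩ := this
      exact ⟨X i, ⟨X i, ⟨MvPolynomial.X i, by simp⟩, rfl⟩, hi⟩) ⟨K.domRestrict f, hf.domRestrict⟩ ε hε
  refine ⟨p, fun x hx => ?_⟩
  have := (ContinuousMap.norm_coe_le_norm _ (⟨x, hx⟩ : K)).trans_lt hg
  rw [ContinuousMap.sub_apply, Real.norm_eq_abs] at this
  rw [← hX p ⟨x, hx⟩]
  exact this

/-- Approximate solvability of the Dirichlet problem for `dirOp` on a ball. -/
theorem exists_dirichlet_near (hN : ∀ k, 0 ≤ N k) (hN' : 0 < ∑ k, N k)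
    (x₀ : EuclideanSpace ℝ (Fin n)) {r : ℝ} (hr : 0 < r) (c : ℝ)
    {f : EuclideanSpace ℝ (Fin n) → ℝ} (hf : ContinuousOn f (Metric.sphere x₀ r)) {ε : ℝ}
    (hε : 0 < ε) :
    ∃ h : EuclideanSpace ℝ (Fin n) → ℝ, ContDiff ℝ 2 h ∧ (∀ x, dirOp N b h x = c) ∧
      ∀ x ∈ Metric.sphere x₀ r, f x ≤ h x ∧ h x ≤ f x + ε := by
  -- Approximating `f + ε / 2` within `ε / 2` gives a one-sided bound.
  obtain ⟨p, hp⟩ := exists_polynomial_near (isCompact_sphere x₀ r)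
    (hf.add (continuousOn_const (c := ε / 2))) (half_pos hε)
  obtain ⟨h, hh, hhp⟩ := exists_polynomial_dirichlet b hN hN' x₀ hr c p
  refine ⟨_, contDiff_eval h, hh, fun x hx => ?_⟩
  have := abs_lt.1 (hp x hx)
  rw [hhp x hx]
  simp only [Pi.add_apply] at this
  constructor <;> linarith

end PolynomialDirichlet


/-! ### Linear viscosity subsolutions and their convex combinations -/

open scoped Manifold ContDiff in
/-- A function touching `u` from above near `x` can be replaced by one touching it from above
in all of `Ω`. -/
theorem exists_global_touching {n : ℕ} {Ω : Set (EuclideanSpace ℝ (Fin n))} (hΩ : IsOpen Ω)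
    {u ψ : EuclideanSpace ℝ (Fin n) → ℝ} (hu : ContinuousOn u Ω)
    {x : EuclideanSpace ℝ (Fin n)} (hx : x ∈ Ω) (hψ : ContDiffAt ℝ 2 ψ x)
    (hle : ∀ᶠ y in nhds x, u y ≤ ψ y) :
    ∃ φ : EuclideanSpace ℝ (Fin n) → ℝ, ContDiffOn ℝ 2 φ Ω ∧ (∀ y ∈ Ω, u y ≤ φ y) ∧
      φ =ᶠ[nhds x] ψ := by
  obtain ⟨s, hs, hball⟩ := Metric.eventually_nhds_iff_ball.1
    (hle.and (hψ.eventually (by simp)))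
  let U : TopologicalSpace.Opens (EuclideanSpace ℝ (Fin n)) := ⟨Ω, hΩ⟩
  let C := Metric.closedBall x (s / 2)
  -- The constraints are convex at each point, so local choices glue by a partition of unity: `ψ`
  -- near the closed ball `C`, a constant above `u` away from it.
  let t : U → Set ℝ := fun y => {z | u y ≤ z ∧ ((y : EuclideanSpace ℝ (Fin n)) ∈ C → z = ψ y)}
  have ht : ∀ y, Convex ℝ (t y) := fun y =>
    (convex_Ici (u y)).inter (convex_singleton (ψ y)).setOfPred_const_imp
  have : LocallyCompactSpace U := hΩ.locallyCompactSpace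
  have hloc : ∀ y : U, ∃ W ∈ nhds y, ∃ g : U → ℝ,
      ContMDiffOn 𝓘(ℝ, EuclideanSpace ℝ (Fin n)) 𝓘(ℝ, ℝ) 2 g W ∧ ∀ z ∈ W, g z ∈ t z := by
    intro y
    by_cases hy : (y : EuclideanSpace ℝ (Fin n)) ∈ C
    · have hyb : (y : EuclideanSpace ℝ (Fin n)) ∈ Metric.ball x s :=
        Metric.closedBall_subset_ball (half_lt_self hs) hy
      have hW : (Subtype.val ⁻¹' Metric.ball x s : Set U) ∈ nhds y :=
        continuous_subtype_val.continuousAt.preimage_mem_nhds (Metric.isOpen_ball.mem_nhds hyb)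
      refine ⟨_, hW, fun y => ψ y, ?_, ?_⟩
      · intro z hz
        refine ContMDiffAt.contMDiffWithinAt ?_
        rw [contMDiffAt_subtype_iff]
        exact (hball z hz).2.contMDiffAt
      · exact fun z hz => ⟨(hball z hz).1, fun _ => rfl⟩
    · have hcont : Continuous fun z : U => u z := hu.domRestrict
      have hopen : IsOpen ({z : U | (z : EuclideanSpace ℝ (Fin n)) ∈ Cᶜ} ∩
          {z : U | u z < u y + 1}) :=
        (Metric.isClosed_closedBall.isOpen_compl.preimage continuous_subtype_val).inter
          (isOpen_lt hcont continuous_const)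
      exact ⟨_, hopen.mem_nhds ⟨hy, lt_add_one (u y)⟩, fun _ => u y + 1, contMDiffOn_const,
        fun z hz => ⟨hz.2.le, fun h => absurd h hz.1⟩⟩
  obtain ⟨g, hg⟩ := exists_contMDiffMap_forall_mem_convex_of_local
    𝓘(ℝ, EuclideanSpace ℝ (Fin n)) (n := 2) ht hloc
  classical
  let φ : EuclideanSpace ℝ (Fin n) → ℝ := fun y => if h : y ∈ Ω then g ⟨y, h⟩ else 0
  have hφ : ∀ y : U, φ y = g y := fun y => dif_pos y.2
  refine ⟨φ, fun y hy => ?_, fun y hy => ?_, ?_⟩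
  · refine ContDiffAt.contDiffWithinAt (contMDiffAt_iff_contDiffAt.1 ?_)
    rw [← contMDiffAt_subtype_iff (U := U) (x := ⟨y, hy⟩)]
    simp only [hφ]
    exact g.contMDiff.contMDiffAt
  · rw [hφ ⟨y, hy⟩]
    exact (hg ⟨y, hy⟩).1
  · filter_upwards [hΩ.mem_nhds hx, Metric.closedBall_mem_nhds x (half_pos hs)] with y hy hyC
    rw [hφ ⟨y, hy⟩]
    exact (hg ⟨y, hy⟩).2 hyC

/-- The quadratic form of the Hessian matrix is the second derivative. -/
theorem dotProduct_hessian_mulVec {n : ℕ} (φ : EuclideanSpace ℝ (Fin n) → ℝ)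
    (x v : EuclideanSpace ℝ (Fin n)) :
    v ⬝ᵥ (hessian φ x).mulVec v = fderiv ℝ (fderiv ℝ φ) x v v := by
  have hv : v = ∑ i, v i • EuclideanSpace.single i (1 : ℝ) := by
    have := (EuclideanSpace.basisFun (Fin n) ℝ).sum_repr v
    simpa using this.symm
  conv_rhs => rw [hv]
  simp only [map_sum, map_smul, sum_apply, smul_apply, smul_eq_mul, hessian, dotProduct,
    Matrix.mulVec, Matrix.of_apply, Finset.mul_sum]
  rw [Finset.sum_comm]
  refine Finset.sum_congr rfl fun i _ => Finset.sum_congr rfl fun j _ => ?_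
  ring

/-- Viscosity subsolutions of `λ(D²u) ∈ ∂V` are subsolutions of every linear equation whose
half-space contains the matrices with eigenvalues in the closure of `V`. -/
theorem IsViscositySubsolution.isLocalSubsolution {n : ℕ}
    {V Ω : Set (EuclideanSpace ℝ (Fin n))} (hΩ : IsOpen Ω) {u : EuclideanSpace ℝ (Fin n) → ℝ}
    (huc : ContinuousOn u Ω) (hu : IsViscositySubsolution V Ω fun x => (u x : EReal))
    {N : Fin n → ℝ} {b : OrthonormalBasis (Fin n) ℝ (EuclideanSpace ℝ (Fin n))} {c : ℝ}
    (hc : ∀ M : Matrix (Fin n) (Fin n) ℝ, M.IsHermitian → eigenvalueVector M ∈ closure V →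
        c ≤ ∑ k, N k * (b k ⬝ᵥ M.mulVec (b k))) :
    IsLocalSubsolution N b c Ω u := by
  intro x hx ψ hψ hle heq
  obtain ⟨φ, hφ, huφ, hφψ⟩ := exists_global_touching hΩ huc hx hψ hle
  have h1 := hc _ (hessian_isHermitian hΩ hφ hx) (hu.2.2.2 x hx φ hφ
    (congrArg _ (heq.trans hφψ.eq_of_nhds.symm)) fun y hy => EReal.coe_le_coe_iff.2 (huφ y hy))
  rw [← dirOp_congr hφψ]
  simpa only [dotProduct_hessian_mulVec, dirOp] using h1

/-- Convex combinations of local subsolutions of a linear equation are subsolutions. -/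
theorem IsLocalSubsolution.convexComb {n : ℕ} {Ω : Set (EuclideanSpace ℝ (Fin n))}
    (hΩ : IsOpen Ω) {N : Fin n → ℝ} (hN : ∀ k, 0 ≤ N k) (hN' : 0 < ∑ k, N k)
    {b : OrthonormalBasis (Fin n) ℝ (EuclideanSpace ℝ (Fin n))} {c : ℝ}
    {u v : EuclideanSpace ℝ (Fin n) → ℝ} (hu : IsLocalSubsolution N b c Ω u)
    (huc : ContinuousOn u Ω) (hv : IsLocalSubsolution N b c Ω v) (hvc : ContinuousOn v Ω)
    {α : ℝ} (hα₀ : 0 ≤ α) (hα₁ : α ≤ 1) :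
    IsLocalSubsolution N b c Ω fun x => α * u x + (1 - α) * v x := by
  intro x₀ hx₀ φ hφ hle heq
  by_contra! hlt
  set S := ∑ k, N k with hS
  -- Adding `δ‖y - x₀‖²` raises `dirOp` by `2 * δ * S`, half of the deficit at `x₀`, so `φ` stays a
  -- strict supersolution nearby.
  set δ := (c - dirOp N b φ x₀) / (4 * S) with hδ
  have hδ0 : 0 < δ := by have := sub_pos.2 hlt; positivity
  have hδS : dirOp N b φ x₀ < c - 2 * δ * S := by
    rw [hδ]
    have : 2 * ((c - dirOp N b φ x₀) / (4 * S)) * S = (c - dirOp N b φ x₀) / 2 := by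
      field_simp
      ring
    linarith
  obtain ⟨s, hs, hball⟩ := Metric.eventually_nhds_iff_ball.1
    ((hle.and (hφ.eventually (by simp))).and ((hΩ.eventually_mem hx₀).and
      ((continuousAt_dirOp hφ).eventually_lt_const hδS)))
  set r := s / 2 with hr
  have hr0 : 0 < r := half_pos hs
  have hsub : Metric.closedBall x₀ r ⊆ Metric.ball x₀ s :=
    Metric.closedBall_subset_ball (half_lt_self hs)
  have hΩr : Metric.closedBall x₀ r ⊆ Ω := fun y hy => (hball y (hsub hy)).2.1
  have hε : 0 < δ * r ^ 2 / 2 := by positivity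
  have happrox : ∀ w : EuclideanSpace ℝ (Fin n) → ℝ, IsLocalSubsolution N b c Ω w →
      ContinuousOn w Ω → ∃ h : EuclideanSpace ℝ (Fin n) → ℝ, ContDiff ℝ 2 h ∧
        (∀ x, dirOp N b h x = c) ∧ w x₀ ≤ h x₀ ∧
        ∀ x ∈ Metric.sphere x₀ r, h x ≤ w x + δ * r ^ 2 / 2 := by
    intro w hw hwc
    obtain ⟨h, hh, hhc, hhs⟩ := exists_dirichlet_near b hN hN' x₀ hr0 c
      (hwc.mono (Metric.sphere_subset_closedBall.trans hΩr)) hε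
    refine ⟨h, hh, hhc, ?_, fun x hx => (hhs x hx).2⟩
    have hw' : IsLocalSubsolution N b c (Metric.ball x₀ r) w := fun x hx =>
      hw x (hΩr (Metric.ball_subset_closedBall hx))
    exact hw'.le_of_le_on_sphere hN' (hwc.mono hΩr) hh.continuous.continuousOn
      (fun _ _ => hh.contDiffAt) (fun x _ => (hhc x).le) (fun x hx => (hhs x hx).1)
      (Metric.mem_ball_self hr0)
  obtain ⟨f, hf, hfc, hfx, hfs⟩ := happrox u hu huc
  obtain ⟨g, hg, hgc, hgx, hgs⟩ := happrox v hv hvc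
  have hα : 0 ≤ 1 - α := sub_nonneg.2 hα₁
  have hf' : ContDiff ℝ 2 fun y => α * f y := contDiff_const.mul hf
  have hg' : ContDiff ℝ 2 fun y => (1 - α) * g y := contDiff_const.mul hg
  have hH : IsLocalSubsolution N b c (Metric.ball x₀ r) fun y => α * f y + (1 - α) * g y := by
    refine isLocalSubsolution_of_contDiffAt hN (fun x _ => (hf'.add hg').contDiffAt) fun x _ => ?_
    rw [dirOp_add hf'.contDiffAt hg'.contDiffAt, dirOp_const_mul hf.contDiffAt,
      dirOp_const_mul hg.contDiffAt, hfc, hgc]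
    linarith
  have hq : ContDiff ℝ 2 fun y : EuclideanSpace ℝ (Fin n) => ‖y - x₀‖ ^ 2 :=
    (contDiff_id.sub contDiff_const).norm_sq ℝ
  have hq' : ContDiff ℝ 2 fun y : EuclideanSpace ℝ (Fin n) => δ * ‖y - x₀‖ ^ 2 :=
    contDiff_const.mul hq
  have hφb : ∀ y ∈ Metric.closedBall x₀ r, ContDiffAt ℝ 2 φ y := fun y hy =>
    (hball y (hsub hy)).1.2
  have hφc : ContinuousOn φ (Metric.closedBall x₀ r) := fun y hy =>
    (hφb y hy).continuousAt.continuousWithinAt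
  -- On the sphere the added terms equal `δ * r ^ 2 / 2`, exactly the approximation error; at the
  -- centre they equal `-(δ * r ^ 2 / 2)`, which contradicts contact with `φ`.
  have hcomp := hH.le_of_le_on_sphere
    (h := fun y => φ y + δ * ‖y - x₀‖ ^ 2 + -(δ * r ^ 2 / 2)) hN'
    (hf'.add hg').continuous.continuousOn
    ((hφc.add
      hq'.continuous.continuousOn).add continuousOn_const)
    (fun y hy => ((hφb y (Metric.ball_subset_closedBall hy)).add hq'.contDiffAt).add
      contDiffAt_const) ?_ ?_ (Metric.mem_ball_self hr0)
  · simp only [sub_self, norm_zero] at hcomp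
    have h1 := mul_le_mul_of_nonneg_left hfx hα₀
    have h2 := mul_le_mul_of_nonneg_left hgx hα
    linarith
  · intro y hy
    have hy' := Metric.ball_subset_closedBall hy
    rw [dirOp_add ((hφb y hy').add hq'.contDiffAt) contDiffAt_const, dirOp_const,
      dirOp_add (hφb y hy') hq'.contDiffAt, dirOp_const_mul hq.contDiffAt, dirOp_norm_sub_sq]
    simp only [b.orthonormal.1, ← Finset.sum_mul]
    have := (hball y (hsub hy')).2.2
    linarith
  · intro y hy
    have h1 := mul_le_mul_of_nonneg_left (hfs y hy) hα₀
    have h2 := mul_le_mul_of_nonneg_left (hgs y hy) hα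
    have h3 := (hball y (hsub (Metric.sphere_subset_closedBall hy))).1.1
    rw [mem_sphere_iff_norm] at hy
    simp only [hy]
    linarith

end ViscositySpectral

end

/-! ### Conclusion -/

open ViscositySpectral in
theorem mainTheorem6 (n : ℕ) (V Ω : Set (EuclideanSpace ℝ (Fin n)))
    (hV : ViscositySpectral.IsAdmissible V) (hΩ : IsOpen Ω) (hΩ' : IsConnected Ω)
    (u v : EuclideanSpace ℝ (Fin n) → ℝ)
    (hu : ViscositySpectral.IsViscositySolution V Ω u)
    (hv : ViscositySpectral.IsViscositySolution V Ω v)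
    (α : ℝ) (hα₀ : 0 < α) (hα₁ : α < 1) :
    ViscositySpectral.IsViscositySubsolution V Ω
      (fun x => ((α * u x + (1 - α) * v x : ℝ) : EReal)) := by
  have hw : ContinuousOn (fun x => α * u x + (1 - α) * v x) Ω :=
    (continuousOn_const.mul hu.1).add (continuousOn_const.mul hv.1)
  obtain ⟨x₁, hx₁⟩ := hΩ'.nonempty
  refine ⟨(continuous_coe_real_ereal.comp_continuousOn hw).upperSemicontinuousOn,
    fun x _ => EReal.coe_ne_top _, ⟨x₁, hx₁, EReal.coe_ne_bot _⟩, fun x₀ hx₀ φ hφ heq hle => ?_⟩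
  by_contra hmem
  obtain ⟨N, b, c, hN, hN', hlt, hc⟩ :=
    hV.exists_linear_bound (hessian_isHermitian hΩ hφ hx₀) hmem
  have hsub := IsLocalSubsolution.convexComb hΩ (fun k => (hN k).le) hN'
    (hu.2.1.isLocalSubsolution hΩ hu.1 hc) hu.1 (hv.2.1.isLocalSubsolution hΩ hv.1 hc) hv.1
    hα₀.le hα₁.le
  have hφx : c ≤ dirOp N b φ x₀ := hsub x₀ hx₀ φ (hφ.contDiffAt (hΩ.mem_nhds hx₀))
    (Filter.eventually_of_mem (hΩ.mem_nhds hx₀) fun y hy => EReal.coe_le_coe_iff.1 (hle y hy))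
    (EReal.coe_eq_coe_iff.1 heq)
  simp only [dotProduct_hessian_mulVec] at hlt
  exact hφx.not_gt hlt
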